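/- For a nonzero polynomial $P(x)=\sum_{j=0}^d a_jx^j$ of degree $d$, let $M(P)=\exp\left(\frac1{2\pi}\int_0^{2\pi}\log|P(e^{it})|\,dt\right)$ be its Mahler measure and $L(P)=\sum_{j=0}^d|a_j|$ its length, and let $|P^{-1}(0)\cap\mathbb R|$ be the number of real zeros of $P$, counted with multiplicity. Let $c>1$ be the real number such that $c\log c=1+c$ ($c=3.59\ldots$). Let $P\in\mathbb Z[x]$ be of degree $d$ with $P(0)P(1)P(-1)\neq0$. Then $$|P^{-1}(0)\cap\mathbb R|\le 2\sqrt{2c\,d\log M(P)}+2(c+1)\log M(P)+(\log c)^{-1}\log(1+d^2)+2(\log c)^{-1}\log L(P).$$ Moreover, for every $\varepsilon>0$ there exists $D_0(\varepsilon)$, depending only on $\varepsilon$, such that for every constant $c_1>0$ and every $P\in\mathbb Z[x]$ of degree $d\ge D_0(\varepsilon)$ with $P(0)P(1)P(-1)\ne0$ and $\log L(P)\le c_1\sqrt{d\log M(P)}$, $$|P^{-1}(0)\cap\mathbb R|\le (c_2+\varepsilon)\sqrt{d\log M(P)},\qquad c_2=2\left(\sqrt{2c}+c+1+(\log c)^{-1}c_1\right).$$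 -/

import Mathlib

open Polynomial

noncomputable section

open Classical in
/-- The number of zeros, counted with multiplicity, of the (nonzero) complex polynomial `P` that
lie in the set `A`. -/
def zeroCount (P : ℂ[X]) (A : Set ℂ) : ℕ :=
  Multiset.card (P.roots.filter (fun z => z ∈ A))

/-- The length of a complex polynomial: the sum of the absolute values of its coefficients. -/
def polyLength (P : ℂ[X]) : ℝ :=
  ∑ j ∈ Finset.range (P.natDegree + 1), ‖P.coeff j‖

/-- An integer polynomial, viewed as a complex polynomial. -/
def toComplexPoly (P : ℤ[X]) : ℂ[X] := P.map (Int.castRingHom ℂ)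

/-- The number of real zeros, counted with multiplicity, of an integer polynomial. -/
def realZeroCount (P : ℤ[X]) : ℕ :=
  zeroCount (toComplexPoly P) (Set.range ((↑) : ℝ → ℂ))

end

/-! Real zeros are split by modulus. With m = log M(P), Jensen's formula and the integrality of P(0)
and of the leading coefficient give ∑ |log |α|| ≤ 2m over all zeros, so at most 2m / log(1+ρ) zeros
have |log |α|| ≥ log(1+ρ). The remaining real zeros lie within ρ of 1 or -1, where |P| ≥ 1; the
maximum principle on radius cρ bounds their number by the length and d·cρ
(`pow_card_le_polyLength_sq`). Balancing the two counts gives ρ ≈ √(2m/(cd)). The resulting bound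
has no log(1+d²) term, and the second claim holds with D₀ = 0. -/

/-! ### Zeros near a point of the unit circle -/

/-- Zeros in the disc of radius `ρ` about `a` can be reflected in the circle of radius `c * ρ`
about `a`: this keeps the absolute value on that circle and enlarges it at `a`. -/
theorem exists_reflect_roots (a : ℂ) (c ρ : ℝ) (hc : 1 < c) (hρ : 0 < ρ) (s : Multiset ℂ)
    (Q : ℂ[X]) (hs : ∀ z ∈ s, ‖z - a‖ ≤ ρ) :
    ∃ G : ℂ[X], (∀ z, ‖z - a‖ = c * ρ →
        ‖G.eval z‖ = ‖((s.map fun α => X - C α).prod * Q).eval z‖) ∧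
      c ^ (Multiset.card s) * ‖((s.map fun α => X - C α).prod * Q).eval a‖ ≤ ‖G.eval a‖ := by
  induction s using Multiset.induction with
  | empty => exact ⟨Q, by simp, by simp⟩
  | cons α t ih =>
    obtain ⟨G, hG, hGa⟩ := ih fun z hz => hs z (Multiset.mem_cons_of_mem hz)
    have hα : ‖α - a‖ ≤ ρ := hs α (Multiset.mem_cons_self α t)
    have hr : 0 < c * ρ := by positivity
    have hr0 : ((c * ρ : ℝ) : ℂ) ≠ 0 := by exact_mod_cast hr.ne'
    -- With r = cρ, the Blaschke-type factor r - conj(α - a)(z - a)/r has modulus |z - α| on the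
    -- circle and equals r ≥ c|a - α| at a.
    refine ⟨(C ((c * ρ : ℝ) : ℂ) -
      C ((starRingEnd ℂ) (α - a) / ((c * ρ : ℝ) : ℂ)) * (X - C a)) * G, fun z hz => ?_, ?_⟩
    · rw [Multiset.map_cons, Multiset.prod_cons, mul_assoc, eval_mul, eval_mul, norm_mul,
        norm_mul, hG z hz]
      congr 1
      have hzz : (z - a) * (starRingEnd ℂ) (z - a) = ((c * ρ : ℝ) : ℂ) * ((c * ρ : ℝ) : ℂ) := by
        rw [Complex.mul_conj, Complex.normSq_eq_norm_sq, hz]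
        push_cast
        ring
      have key : eval z (C ((c * ρ : ℝ) : ℂ) -
          C ((starRingEnd ℂ) (α - a) / ((c * ρ : ℝ) : ℂ)) * (X - C a)) =
          (z - a) * (starRingEnd ℂ) (z - α) / ((c * ρ : ℝ) : ℂ) := by
        rw [eq_div_iff hr0]
        have h2 : (starRingEnd ℂ) (z - α) =
            (starRingEnd ℂ) (z - a) - (starRingEnd ℂ) (α - a) := by
          rw [← map_sub]; ring_nf
        rw [h2, mul_sub (z - a), hzz]
        simp only [eval_sub, eval_C, eval_mul, eval_X]
        rw [sub_mul, mul_assoc, div_mul_eq_mul_div, ← mul_assoc ((starRingEnd ℂ) (α - a)),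
          mul_div_cancel_right₀ _ hr0]
        ring
      rw [key, norm_div, norm_mul, hz, RCLike.norm_conj, Complex.norm_real, Real.norm_eq_abs,
        abs_of_pos hr, mul_div_cancel_left₀ _ hr.ne']
      simp
    · rw [Multiset.map_cons, Multiset.prod_cons, mul_assoc, Multiset.card_cons, pow_succ]
      generalize (t.map fun α => X - C α).prod * Q = R at hGa
      rw [eval_mul, eval_mul, norm_mul, norm_mul]
      have h1 : ‖eval a (X - C α)‖ ≤ ρ := by
        rw [eval_sub, eval_X, eval_C, norm_sub_rev]; exact hα
      have h2 : ‖eval a (C ((c * ρ : ℝ) : ℂ) -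
          C ((starRingEnd ℂ) (α - a) / ((c * ρ : ℝ) : ℂ)) * (X - C a))‖ = c * ρ := by
        simp [abs_of_pos hρ, abs_of_pos (zero_lt_one.trans hc)]
      rw [h2]
      calc _ = (c * ‖eval a (X - C α)‖) * (c ^ (Multiset.card t) *
            ‖eval a R‖) := by ring
        _ ≤ (c * ρ) * ‖eval a G‖ := by gcongr

theorem norm_eval_le_polyLength (P : ℂ[X]) (z : ℂ) :
    ‖P.eval z‖ ≤ polyLength P * max 1 ‖z‖ ^ P.natDegree := by
  rw [eval_eq_sum_range, polyLength, Finset.sum_mul]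
  refine (norm_sum_le _ _).trans (Finset.sum_le_sum fun j hj => ?_)
  rw [norm_mul, norm_pow]
  have hj' : j ≤ P.natDegree := Nat.lt_succ_iff.mp (Finset.mem_range.mp hj)
  gcongr
  exact (pow_le_pow_left₀ (norm_nonneg z) (le_max_right 1 _) j).trans
    (pow_le_pow_right₀ (le_max_left 1 _) hj')

/-- Bounds the growth of P² / z^d on a circle of radius r about a: each degree costs only 1/(1-r)
for the square of P, which halves the naive exponent. -/
theorem max_one_sq_le {t r : ℝ} (hr : r < 1) (h1 : 1 - r ≤ t) (h2 : t ≤ 1 + r) :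
    max 1 t ^ 2 ≤ (1 - r)⁻¹ * t := by
  have h0 : 0 < 1 - r := by linarith
  rw [inv_mul_eq_div, le_div_iff₀ h0]
  rcases le_total t 1 with h | h
  · rw [max_eq_left h]; linarith
  · rw [max_eq_right h]
    have : t * (1 - r) ≤ 1 := by nlinarith
    nlinarith

/-- A Jensen-type bound for the number of zeros near a point `a` of the unit circle. -/
theorem pow_card_le_polyLength_sq (P : ℂ[X]) (a : ℂ) (ha : ‖a‖ = 1) (hPa : 1 ≤ ‖P.eval a‖)
    (c ρ : ℝ) (hc : 1 < c) (hρ : 0 < ρ) (hr : c * ρ < 1) (s : Multiset ℂ) (hsP : s ≤ P.roots)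
    (hs : ∀ z ∈ s, ‖z - a‖ ≤ ρ) :
    c ^ (2 * Multiset.card s) ≤ polyLength P ^ 2 * (1 - c * ρ)⁻¹ ^ P.natDegree := by
  have hP0 : P ≠ 0 := by
    rintro rfl
    simp at hPa
    linarith
  obtain ⟨Q, hQ⟩ := (Multiset.prod_X_sub_C_dvd_iff_le_roots hP0 s).2 hsP
  obtain ⟨G, hG, hGa⟩ := exists_reflect_roots a c ρ hc hρ s Q hs
  rw [← hQ] at hGa
  simp_rw [← hQ] at hG
  have hr0 : 0 < c * ρ := by positivity
  have hball : ∀ z ∈ Metric.closedBall a (c * ρ), 1 - c * ρ ≤ ‖z‖ ∧ ‖z‖ ≤ 1 + c * ρ := by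
    intro z hz
    rw [mem_closedBall_iff_norm] at hz
    have h1 := norm_sub_norm_le a z
    have h2 := norm_sub_norm_le z a
    rw [norm_sub_rev] at h1
    constructor <;> linarith
  have hne : ∀ z ∈ Metric.closedBall a (c * ρ), z ^ P.natDegree ≠ 0 := by
    intro z hz
    have := (hball z hz).1
    exact pow_ne_zero _ (norm_pos_iff.mp (by linarith))
  -- Dividing by z^d leaves the modulus at a unchanged, since |a| = 1.
  have hd : DiffContOnCl ℂ (fun z => (G.eval z) ^ 2 / z ^ P.natDegree)
      (Metric.ball a (c * ρ)) := by
    apply DifferentiableOn.diffContOnCl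
    rw [closure_ball a hr0.ne']
    intro z hz
    exact ((G.differentiable.differentiableAt.pow 2).div
      (differentiableAt_id.pow _) (hne z hz)).differentiableWithinAt
  have hmax := Complex.norm_le_of_forall_mem_frontier_norm_le Metric.isBounded_ball hd
    (C := polyLength P ^ 2 * (1 - c * ρ)⁻¹ ^ P.natDegree) (fun z hz => ?_)
    (subset_closure (Metric.mem_ball_self hr0))
  · rw [norm_div, norm_pow, norm_pow, ha, one_pow, div_one] at hmax
    refine le_trans ?_ hmax
    have hc0 : 0 ≤ c ^ Multiset.card s := by positivity
    calc c ^ (2 * Multiset.card s) = (c ^ Multiset.card s * 1) ^ 2 := by ring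
      _ ≤ ‖G.eval a‖ ^ 2 := by
        gcongr
        exact (mul_le_mul_of_nonneg_left hPa hc0).trans hGa
  · rw [frontier_ball a hr0.ne'] at hz
    have hz' := Metric.sphere_subset_closedBall hz
    have hzpos : 0 < ‖z‖ := by linarith [(hball z hz').1]
    rw [mem_sphere_iff_norm] at hz
    rw [norm_div, norm_pow, norm_pow, hG z hz, div_le_iff₀ (by positivity)]
    calc ‖P.eval z‖ ^ 2 ≤ (polyLength P * max 1 ‖z‖ ^ P.natDegree) ^ 2 := by
          gcongr; exact norm_eval_le_polyLength P z
      _ = polyLength P ^ 2 * (max 1 ‖z‖ ^ 2) ^ P.natDegree := by ring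
      _ ≤ polyLength P ^ 2 * ((1 - c * ρ)⁻¹ * ‖z‖) ^ P.natDegree := by
          gcongr
          exact max_one_sq_le hr (hball z hz').1 (hball z hz').2
      _ = _ := by rw [mul_pow, mul_assoc]

theorem abs_log_eq_two_mul_posLog_sub (t : ℝ) : |Real.log t| = 2 * Real.posLog t - Real.log t := by
  rw [Real.posLog]
  rcases le_total 0 (Real.log t) with h | h
  · rw [max_eq_right h, abs_of_nonneg h]; ring
  · rw [max_eq_left h, abs_of_nonpos h]; ring

theorem log_inv_one_sub_le {r : ℝ} (h0 : 0 ≤ r) (h1 : r ≤ 1 / 2) :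
    Real.log (1 - r)⁻¹ ≤ r + r ^ 2 := by
  have hpos : 0 < 1 - r := by linarith
  rw [Real.log_le_iff_le_exp (inv_pos.mpr hpos)]
  refine le_trans ?_ (Real.quadratic_le_exp_of_nonneg (by positivity))
  rw [inv_le_iff_one_le_mul₀ hpos]
  -- With x = r + r², (1-r)(1 + x + x²/2) - 1 equals r²/2 times this quantity.
  have h2 : 0 ≤ 1 - r - r ^ 2 - r ^ 3 := by
    have : r ^ 2 ≤ (1 / 2) ^ 2 := by gcongr
    have : r ^ 3 ≤ (1 / 2) ^ 3 := by gcongr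
    linarith
  have := mul_nonneg (sq_nonneg r) h2
  linarith

theorem inv_log_one_add_le {ρ : ℝ} (h : 0 < ρ) : (Real.log (1 + ρ))⁻¹ ≤ ρ⁻¹ + 1 / 2 := by
  have h1 : 2 * ρ / (ρ + 2) ≤ Real.log (1 + ρ) := Real.le_log_one_add_of_nonneg h.le
  have h2 : 0 < 2 * ρ / (ρ + 2) := by positivity
  refine (inv_anti₀ h2 h1).trans (le_of_eq ?_)
  field_simp
  ring

theorem card_mul_log_le (P : ℂ[X]) (a : ℂ) (ha : ‖a‖ = 1) (hPa : 1 ≤ ‖P.eval a‖)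
    (c ρ : ℝ) (hc : 1 < c) (hρ : 0 < ρ) (hr : c * ρ ≤ 1 / 2) (s : Multiset ℂ)
    (hsP : s ≤ P.roots) (hs : ∀ z ∈ s, ‖z - a‖ ≤ ρ) :
    2 * (Multiset.card s : ℝ) * Real.log c ≤
      2 * Real.log (polyLength P) + P.natDegree * (c * ρ + (c * ρ) ^ 2) := by
  have hr1 : 0 < 1 - c * ρ := by linarith
  have hL : 0 < polyLength P := by
    have := hPa.trans (norm_eval_le_polyLength P a)
    rw [ha, max_self, one_pow, mul_one] at this
    linarith
  have h := Real.log_le_log (by positivity)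
    (pow_card_le_polyLength_sq P a ha hPa c ρ hc hρ (by linarith) s hsP hs)
  rw [Real.log_mul (by positivity) (by positivity), Real.log_pow, Real.log_pow, Real.log_pow] at h
  push_cast at h
  refine h.trans ?_
  gcongr
  exact log_inv_one_sub_le (by positivity) hr

/-! ### Mahler measure and moduli of zeros -/

theorem toComplexPoly_ne_zero {P : ℤ[X]} (h : P.eval 0 ≠ 0) : toComplexPoly P ≠ 0 := by
  rw [toComplexPoly, Polynomial.map_ne_zero_iff (RingHom.injective_int _)]
  rintro rfl
  simp at h

theorem natDegree_toComplexPoly (P : ℤ[X]) : (toComplexPoly P).natDegree = P.natDegree :=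
  natDegree_map_eq_of_injective (RingHom.injective_int _) P

theorem one_le_norm_intCast {n : ℤ} (h : n ≠ 0) : 1 ≤ ‖(n : ℂ)‖ := by
  rw [Complex.norm_intCast]
  exact_mod_cast Int.one_le_abs h

theorem one_le_norm_eval_toComplexPoly {P : ℤ[X]} {n : ℤ} (h : P.eval n ≠ 0) :
    1 ≤ ‖(toComplexPoly P).eval (n : ℂ)‖ := by
  have : (toComplexPoly P).eval (n : ℂ) = (P.eval n : ℤ) := by
    simp [toComplexPoly]
  rw [this]
  exact one_le_norm_intCast h

theorem ne_zero_of_mem_roots_toComplexPoly {P : ℤ[X]} (h0 : P.eval 0 ≠ 0) {z : ℂ}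
    (hz : z ∈ (toComplexPoly P).roots) : z ≠ 0 := by
  rintro rfl
  have h1 := one_le_norm_eval_toComplexPoly (n := 0) h0
  rw [Int.cast_zero, (isRoot_of_mem_roots hz : eval 0 (toComplexPoly P) = 0), norm_zero] at h1
  linarith

/-- Since |log t| = 2 log⁺ t - log t, the sum equals 2 log M - log |lead| - log |P(0)|, and both
subtracted logarithms are nonnegative by integrality. -/
theorem sum_abs_log_roots_le {P : ℤ[X]} (h0 : P.eval 0 ≠ 0) :
    ((toComplexPoly P).roots.map fun α => |Real.log ‖α‖|).sum ≤
      2 * Real.log (toComplexPoly P).mahlerMeasure := by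
  have hP := toComplexPoly_ne_zero h0
  have hlc : 1 ≤ ‖(toComplexPoly P).leadingCoeff‖ := by
    rw [leadingCoeff, natDegree_toComplexPoly, toComplexPoly, coeff_map]
    refine one_le_norm_intCast (leadingCoeff_ne_zero.mpr ?_)
    rintro rfl
    simp at h0
  have hc0 : 1 ≤ ‖(toComplexPoly P).coeff 0‖ := by
    rw [coeff_zero_eq_eval_zero]
    simpa using one_le_norm_eval_toComplexPoly (n := 0) h0
  have hprod : Real.log ‖(toComplexPoly P).coeff 0‖ =
      Real.log ‖(toComplexPoly P).leadingCoeff‖ +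
        ((toComplexPoly P).roots.map fun α => Real.log ‖α‖).sum := by
    rw [(IsAlgClosed.splits (toComplexPoly P)).coeff_zero_eq_leadingCoeff_mul_prod_roots]
    have hnorm : ‖(toComplexPoly P).roots.prod‖ =
        ((toComplexPoly P).roots.map fun α => ‖α‖).prod :=
      map_multiset_prod (normHom : ℂ →*₀ ℝ) _
    have hne : ∀ x ∈ (toComplexPoly P).roots.map (fun α => ‖α‖), x ≠ 0 := by
      intro x hx
      obtain ⟨z, hz, rfl⟩ := Multiset.mem_map.mp hx
      exact norm_ne_zero_iff.mpr (ne_zero_of_mem_roots_toComplexPoly h0 hz)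
    have hne' : ((toComplexPoly P).roots.map fun α => ‖α‖).prod ≠ 0 :=
      Multiset.prod_ne_zero fun h => hne 0 h rfl
    rw [norm_mul, norm_mul, norm_pow, norm_neg, norm_one, one_pow, one_mul, hnorm,
      Real.log_mul (by positivity) hne', Real.log_multiset_prod hne, Multiset.map_map]
    rfl
  simp_rw [abs_log_eq_two_mul_posLog_sub]
  rw [Multiset.sum_map_sub, Multiset.sum_map_mul_left, ← logMahlerMeasure_eq_log_MahlerMeasure,
    logMahlerMeasure_eq_log_leadingCoeff_add_sum_log_roots]
  have h1 := Real.log_nonneg hlc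
  have h2 := Real.log_nonneg hc0
  linarith

theorem card_mul_le_two_mul_log_mahlerMeasure {P : ℤ[X]} (h0 : P.eval 0 ≠ 0) {δ : ℝ}
    {s : Multiset ℂ} (hsP : s ≤ (toComplexPoly P).roots) (hs : ∀ z ∈ s, δ ≤ |Real.log ‖z‖|) :
    (Multiset.card s : ℝ) * δ ≤ 2 * Real.log (toComplexPoly P).mahlerMeasure := by
  refine le_trans ?_ (sum_abs_log_roots_le h0)
  obtain ⟨t, ht⟩ := Multiset.le_iff_exists_add.mp hsP
  rw [ht, Multiset.map_add, Multiset.sum_add]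
  have h1 : (Multiset.card s : ℝ) * δ ≤ (s.map fun α => |Real.log ‖α‖|).sum := by
    have := Multiset.card_nsmul_le_sum (s := s.map fun α => |Real.log ‖α‖|) (a := δ) (by
      intro x hx
      obtain ⟨z, hz, rfl⟩ := Multiset.mem_map.mp hx
      exact hs z hz)
    simpa using this
  have h2 : 0 ≤ (t.map fun α => |Real.log ‖α‖|).sum := Multiset.sum_nonneg (by
    intro x hx
    obtain ⟨z, _, rfl⟩ := Multiset.mem_map.mp hx
    exact abs_nonneg _)
  linarith

theorem log_mahlerMeasure_nonneg {P : ℤ[X]} (h0 : P.eval 0 ≠ 0) :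
    0 ≤ Real.log (toComplexPoly P).mahlerMeasure := by
  have := card_mul_le_two_mul_log_mahlerMeasure h0 (δ := 0) (s := 0) (Multiset.zero_le _) (by simp)
  simp at this
  linarith

/-! ### Counting real zeros -/

theorem abs_sub_one_le_or_abs_add_one_le {t ρ : ℝ} (hρ : 0 < ρ) (ht : t ≠ 0)
    (h : |Real.log (|t|)| ≤ Real.log (1 + ρ)) : |t - 1| ≤ ρ ∨ |t + 1| ≤ ρ := by
  have ht' : 0 < |t| := abs_pos.mpr ht
  have hρ1 : 0 < 1 + ρ := by linarith
  obtain ⟨h1, h2⟩ := abs_le.mp h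
  have h3 : |t| ≤ 1 + ρ := (Real.log_le_log_iff ht' hρ1).mp h2
  have h4 : 1 - ρ ≤ |t| := by
    rw [← Real.log_inv, Real.log_le_log_iff (by positivity) ht'] at h1
    refine le_trans ?_ h1
    rw [← one_div, le_div_iff₀ hρ1]
    nlinarith
  rcases abs_cases t with ⟨ha, _⟩ | ⟨ha, _⟩
  · left
    rw [abs_le]
    constructor <;> linarith
  · right
    rw [abs_le]
    constructor <;> linarith

theorem realZeroCount_le_natDegree (P : ℤ[X]) : realZeroCount P ≤ P.natDegree := by
  classical
  rw [realZeroCount, zeroCount, ← natDegree_toComplexPoly]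
  exact (Multiset.card_le_card (Multiset.filter_le _ _)).trans (card_roots' _)

theorem realZeroCount_eq_zero_of_log_mahlerMeasure_eq_zero {P : ℤ[X]} (h0 : P.eval 0 ≠ 0)
    (h1 : P.eval 1 ≠ 0) (h2 : P.eval (-1) ≠ 0)
    (hM : Real.log (toComplexPoly P).mahlerMeasure = 0) : realZeroCount P = 0 := by
  classical
  rw [realZeroCount, zeroCount]
  refine Multiset.card_eq_zero.mpr (Multiset.eq_zero_of_forall_notMem fun z hz => ?_)
  obtain ⟨hz, t, rfl⟩ := Multiset.mem_filter.mp hz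
  have hle := card_mul_le_two_mul_log_mahlerMeasure h0 (s := {(t : ℂ)})
    (Multiset.singleton_le.mpr hz) (δ := |Real.log ‖(t : ℂ)‖|) (by simp)
  rw [hM, Multiset.card_singleton, Nat.cast_one, one_mul, mul_zero] at hle
  have hlog := abs_eq_zero.mp (le_antisymm hle (abs_nonneg _))
  have ht0 : ‖(t : ℂ)‖ ≠ 0 := norm_ne_zero_iff.mpr (ne_zero_of_mem_roots_toComplexPoly h0 hz)
  have hroot : (toComplexPoly P).eval (t : ℂ) = 0 := isRoot_of_mem_roots hz
  have hpm : t = 1 ∨ t = -1 := by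
    have := Real.eq_one_of_pos_of_log_eq_zero (by positivity) hlog
    rw [Complex.norm_real, Real.norm_eq_abs] at this
    exact eq_or_eq_neg_of_abs_eq this
  rcases hpm with rfl | rfl
  · have := one_le_norm_eval_toComplexPoly (n := 1) h1
    push_cast at this hroot
    rw [hroot, norm_zero] at this
    linarith
  · have := one_le_norm_eval_toComplexPoly (n := -1) h2
    push_cast at this hroot
    rw [hroot, norm_zero] at this
    linarith

theorem realZeroCount_le_of_radius {P : ℤ[X]} (h0 : P.eval 0 ≠ 0) (h1 : P.eval 1 ≠ 0)
    (h2 : P.eval (-1) ≠ 0) {c ρ : ℝ} (hc : 1 < c) (hρ : 0 < ρ) (hr : c * ρ ≤ 1 / 2) :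
    (realZeroCount P : ℝ) ≤
      2 * Real.log (toComplexPoly P).mahlerMeasure * (Real.log (1 + ρ))⁻¹ +
      (Real.log c)⁻¹ * (2 * Real.log (polyLength (toComplexPoly P)) +
        P.natDegree * (c * ρ + (c * ρ) ^ 2)) := by
  classical
  set R := (toComplexPoly P).roots.filter (fun z => z ∈ Set.range ((↑) : ℝ → ℂ)) with hR
  have hcard : realZeroCount P = Multiset.card R := by
    rw [realZeroCount, zeroCount, hR]
  have hRP : R ≤ (toComplexPoly P).roots := Multiset.filter_le _ _
  set A := R.filter (fun z => Real.log (1 + ρ) ≤ |Real.log ‖z‖|) with hA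
  set B := R.filter (fun z => ¬ Real.log (1 + ρ) ≤ |Real.log ‖z‖|) with hB
  set B₁ := B.filter (fun z => ‖z - 1‖ ≤ ρ) with hB₁
  set B₂ := B.filter (fun z => ¬ ‖z - 1‖ ≤ ρ) with hB₂
  have hRAB : R = A + B := (Multiset.filter_add_not _ _).symm
  have hBB : B = B₁ + B₂ := (Multiset.filter_add_not _ _).symm
  have hBR : B ≤ R := Multiset.filter_le _ _
  have hlogρ : 0 < Real.log (1 + ρ) := Real.log_pos (by linarith)
  have hlogc : 0 < Real.log c := Real.log_pos hc
  have eA : (Multiset.card A : ℝ) ≤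
      2 * Real.log (toComplexPoly P).mahlerMeasure * (Real.log (1 + ρ))⁻¹ := by
    rw [← div_eq_mul_inv, le_div_iff₀ hlogρ]
    exact card_mul_le_two_mul_log_mahlerMeasure h0 ((Multiset.filter_le _ _).trans hRP)
      fun z hz => (Multiset.mem_filter.mp hz).2
  have e₁ := card_mul_log_le (toComplexPoly P) 1 norm_one
    (by simpa using one_le_norm_eval_toComplexPoly (n := 1) h1) c ρ hc hρ hr B₁
    ((Multiset.filter_le _ _).trans (hBR.trans hRP)) fun z hz => (Multiset.mem_filter.mp hz).2
  have e₂ := card_mul_log_le (toComplexPoly P) (-1) (by simp)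
    (by simpa using one_le_norm_eval_toComplexPoly (n := -1) h2) c ρ hc hρ hr B₂
    ((Multiset.filter_le _ _).trans (hBR.trans hRP)) (fun z hz => by
      obtain ⟨hzB, hz1⟩ := Multiset.mem_filter.mp hz
      obtain ⟨hzR, hzl⟩ := Multiset.mem_filter.mp hzB
      obtain ⟨hzP, t, rfl⟩ := Multiset.mem_filter.mp hzR
      have ht : t ≠ 0 := by
        rintro rfl
        exact ne_zero_of_mem_roots_toComplexPoly h0 hzP Complex.ofReal_zero
      rw [Complex.norm_real, Real.norm_eq_abs] at hzl
      have := abs_sub_one_le_or_abs_add_one_le hρ ht (not_le.mp hzl).le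
      have n1 : ‖(t : ℂ) - 1‖ = |t - 1| := by
        rw [← Real.norm_eq_abs, ← Complex.norm_real]; push_cast; rfl
      have n2 : ‖(t : ℂ) - -1‖ = |t + 1| := by
        rw [← Real.norm_eq_abs, ← Complex.norm_real, sub_neg_eq_add]; push_cast; rfl
      rw [n1] at hz1
      rw [n2]
      exact this.resolve_left hz1)
  rw [natDegree_toComplexPoly] at e₁ e₂
  have eB : (Multiset.card B₁ : ℝ) + Multiset.card B₂ ≤
      (Real.log c)⁻¹ * (2 * Real.log (polyLength (toComplexPoly P)) +
        P.natDegree * (c * ρ + (c * ρ) ^ 2)) := by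
    rw [inv_mul_eq_div, le_div_iff₀ hlogc]
    linarith
  rw [hcard, hRAB, Multiset.card_add, hBB, Multiset.card_add]
  push_cast
  linarith

theorem one_le_polyLength_toComplexPoly {P : ℤ[X]} (h1 : P.eval 1 ≠ 0) :
    1 ≤ polyLength (toComplexPoly P) := by
  have h := (one_le_norm_eval_toComplexPoly (n := 1) h1).trans (norm_eval_le_polyLength _ _)
  simpa using h

theorem realZeroCount_le {P : ℤ[X]} (h0 : P.eval 0 ≠ 0) (h1 : P.eval 1 ≠ 0)
    (h2 : P.eval (-1) ≠ 0) {c : ℝ} (hc : 1 < c) (hlogc : 1 ≤ Real.log c) :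
    (realZeroCount P : ℝ) ≤
      2 * √(2 * c * (P.natDegree : ℝ) * Real.log (toComplexPoly P).mahlerMeasure)
      + 2 * (c + 1) * Real.log (toComplexPoly P).mahlerMeasure
      + 2 * (Real.log c)⁻¹ * Real.log (polyLength (toComplexPoly P)) := by
  have hMnn := log_mahlerMeasure_nonneg h0
  have hLnn := Real.log_nonneg (one_le_polyLength_toComplexPoly h1)
  have hNd : (realZeroCount P : ℝ) ≤ P.natDegree := by
    exact_mod_cast realZeroCount_le_natDegree P
  have hl : (Real.log c)⁻¹ ≤ 1 := inv_le_one_of_one_le₀ hlogc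
  have hl0 : 0 ≤ (Real.log c)⁻¹ := by positivity
  rcases hMnn.eq_or_lt with hM | hM
  · rw [realZeroCount_eq_zero_of_log_mahlerMeasure_eq_zero h0 h1 h2 hM.symm]
    push_cast
    positivity
  rcases (Nat.zero_le P.natDegree).eq_or_lt with hd | hd
  · have : realZeroCount P = 0 := by
      have := realZeroCount_le_natDegree P
      omega
    rw [this]
    push_cast
    positivity
  have hmain := fun ρ => realZeroCount_le_of_radius h0 h1 h2 (ρ := ρ) hc
  set m := Real.log (toComplexPoly P).mahlerMeasure
  set l := Real.log (polyLength (toComplexPoly P))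
  have hd' : (0 : ℝ) < P.natDegree := by exact_mod_cast hd
  set d : ℝ := (P.natDegree : ℝ)
  set u := √(2 * c * d * m) with hu
  have hc0 : 0 < c := by linarith
  have hu0 : 0 < u := Real.sqrt_pos.mpr (by positivity)
  have hu2 : u ^ 2 = 2 * c * d * m := Real.sq_sqrt (by positivity)
  -- The choice ρ = u/(cd), so cρ = u/d, makes both main terms equal to u. If u/d > 1/2, then d < 2u
  -- and the trivial bound by the degree suffices.
  rcases lt_or_ge (1 / 2) (u / d) with hr | hr
  · rw [lt_div_iff₀ hd'] at hr
    have : 0 ≤ 2 * (c + 1) * m + 2 * (Real.log c)⁻¹ * l := by positivity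
    linarith
  have hρ : 0 < u / (c * d) := by positivity
  have hcρ : c * (u / (c * d)) = u / d := by field_simp
  have h := hmain _ hρ (by rwa [hcρ])
  rw [hcρ] at h
  have i1 : 2 * m * (Real.log (1 + u / (c * d)))⁻¹ ≤ u + m := by
    calc _ ≤ 2 * m * ((u / (c * d))⁻¹ + 1 / 2) := by
          gcongr; exact inv_log_one_add_le hρ
      _ = 2 * c * d * m / u + m := by field_simp
      _ = u + m := by rw [← hu2]; field_simp
  have i2 : d * (u / d + (u / d) ^ 2) = u + 2 * c * m := by
    have : d * (u / d + (u / d) ^ 2) = u + u ^ 2 / d := by field_simp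
    rw [this, hu2]
    field_simp
  rw [i2] at h
  have i3 : (Real.log c)⁻¹ * (u + 2 * c * m) ≤ u + 2 * c * m :=
    mul_le_of_le_one_left (by positivity) hl
  linarith

theorem mainTheorem5 (c : ℝ) (hc : 1 < c) (hceq : c * Real.log c = 1 + c) :
    (∀ (P : ℤ[X]), P.eval 0 * P.eval 1 * P.eval (-1) ≠ 0 →
      (realZeroCount P : ℝ) ≤
        2 * √(2 * c * (P.natDegree : ℝ) * Real.log (toComplexPoly P).mahlerMeasure)
        + 2 * (c + 1) * Real.log (toComplexPoly P).mahlerMeasure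
        + (Real.log c)⁻¹ * Real.log (1 + (P.natDegree : ℝ) ^ 2)
        + 2 * (Real.log c)⁻¹ * Real.log (polyLength (toComplexPoly P))) ∧
    (∀ ε : ℝ, 0 < ε → ∃ D₀ : ℕ, ∀ c₁ : ℝ, 0 < c₁ → ∀ (P : ℤ[X]),
      P.eval 0 * P.eval 1 * P.eval (-1) ≠ 0 →
      D₀ ≤ P.natDegree →
      Real.log (polyLength (toComplexPoly P)) ≤
        c₁ * √((P.natDegree : ℝ) * Real.log (toComplexPoly P).mahlerMeasure) →
      (realZeroCount P : ℝ) ≤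
        (2 * (√(2 * c) + c + 1 + (Real.log c)⁻¹ * c₁) + ε) *
          √((P.natDegree : ℝ) * Real.log (toComplexPoly P).mahlerMeasure)) := by
  -- This is all that the equation for c contributes: it removes the factor 1/log c from the degree
  -- term.
  have hlogc : 1 ≤ Real.log c := by
    by_contra! h
    nlinarith
  have hl0 : 0 ≤ (Real.log c)⁻¹ := by positivity
  refine ⟨fun P hP => ?_, fun ε hε => ⟨0, fun c₁ hc₁ P hP _ hL => ?_⟩⟩
  all_goals
    obtain ⟨⟨h0, h1⟩, h2⟩ : (P.eval 0 ≠ 0 ∧ P.eval 1 ≠ 0) ∧ P.eval (-1) ≠ 0 := by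
      simpa only [mul_ne_zero_iff] using hP
    have h := realZeroCount_le h0 h1 h2 hc hlogc
  · have : 0 ≤ Real.log (1 + (P.natDegree : ℝ) ^ 2) :=
      Real.log_nonneg (by linarith [sq_nonneg (P.natDegree : ℝ)])
    have := mul_nonneg hl0 this
    linarith
  · have hM := log_mahlerMeasure_nonneg h0
    have hNd : (realZeroCount P : ℝ) ≤ P.natDegree := by
      exact_mod_cast realZeroCount_le_natDegree P
    set m := Real.log (toComplexPoly P).mahlerMeasure
    set d : ℝ := (P.natDegree : ℝ)
    have hd : 0 ≤ d := Nat.cast_nonneg _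
    have hs0 : 0 ≤ √(d * m) := Real.sqrt_nonneg _
    -- If d ≤ m, the degree bound is already at most √(dm); otherwise m ≤ √(dm) absorbs the linear
    -- term.
    rcases le_total d m with hdm | hmd
    · have hds : d ≤ √(d * m) := Real.le_sqrt_of_sq_le (by nlinarith)
      refine (hNd.trans hds).trans (le_mul_of_one_le_left hs0 ?_)
      have := mul_nonneg hl0 hc₁.le
      have := Real.sqrt_nonneg (2 * c)
      linarith
    · have hms : m ≤ √(d * m) := Real.le_sqrt_of_sq_le (by nlinarith)
      have hsplit : √(2 * c * d * m) = √(2 * c) * √(d * m) := by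
        rw [mul_assoc (2 * c), Real.sqrt_mul (by linarith)]
      rw [hsplit] at h
      have j1 := mul_le_mul_of_nonneg_left hms (by linarith : 0 ≤ 2 * (c + 1))
      have j2 := mul_le_mul_of_nonneg_left hL (by linarith : 0 ≤ 2 * (Real.log c)⁻¹)
      have j3 := mul_nonneg hε.le hs0
      linarith
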